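/- All graphs are finite and simple. A graph $G=(V,E)$ is word-representable if there is a word $w$ over the alphabet $V$, in which every letter of $V$ occurs, such that two distinct letters $x,y\in V$ alternate in $w$ (that is, deleting all other letters leaves $xyxy\cdots$ or $yxyx\cdots$) if and only if $xy\in E$. A near-triangulation is a connected plane graph with at least one edge in which every face except possibly the outer face is a triangle. Let $G$ be a near-triangulation whose outer face is a triangle. By a triangle of $G$ we mean a 3-cycle of $G$ (not necessarily bounding a face). A vertex $v$ subdivides a triangle $xyz$ of $G$ if $v$ lies strictly inside $xyz$ and is adjacent to $x$, $y$ and $z$; the three triangles $vxy$, $vyz$, $vxz$ are then said to arise from a face subdivision. (The interiors of these triangles may contain further vertices.) $G$ is of Type 3 if, among its triangles other than the outer triangle, there is at least one that arises from a face subdivision and at least one that does not. Let $A$ be the graph with vertices $0,1,\dots,6$ and edges $13, 35, 15, 61, 63, 65, 01, 05, 21, 23, 43, 45$: a triangle $1\,3\,5$, a vertex $6$ joined to its three vertices, and vertices $0$, $2$, $4$ joined to the two ends of $15$, $13$, $35$ respectively. Let $A'$ be $A$ with the edge $04$ added, $A''$ be $A$ with $02$ and $24$ added, and $A'''$ be $A$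 with $02$, $24$ and $04$ added. **Lemma.** If $G$ is a near-triangulation of Type 3 whose outer face is a triangle, then $G$ contains an induced subgraph isomorphic to one of $A, A', A'', A'''$, and $G$ is not word-representable. -/

import Mathlib

/-! ### Word-representable graphs -/

/-- Two letters `x`, `y` alternate in the word `w`: after deleting all other letters, no two
consecutive letters are equal, i.e. what remains reads `xyxy⋯` or `yxyx⋯`. -/
def WordAlternate {V : Type*} (w : List V) (x y : V) : Prop :=
  open scoped Classical in
  (w.filter (fun a => decide (a = x ∨ a = y))).IsChain (fun a b => a ≠ b)

/-- `G` is word-representable: there is a word over the alphabet `V` (in which, as usual, every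
letter occurs) such that distinct letters alternate if and only if they are adjacent. -/
def WordRepresentable {V : Type*} (G : SimpleGraph V) : Prop :=
  ∃ w : List V, (∀ v, v ∈ w) ∧ ∀ x y : V, x ≠ y → (WordAlternate w x y ↔ G.Adj x y)

/-! ### Plane graphs, as rotation systems of Euler characteristic two -/

/-- A rotation system on `G`: at every vertex, a cyclic order of the darts (oriented edges)
leaving that vertex. -/
structure RotationSystem {V : Type*} (G : SimpleGraph V) where
  /-- the next dart in the cyclic order around the initial vertex -/
  rot : Equiv.Perm G.Dart
  fst_rot : ∀ d, (rot d).fst = d.fst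
  rot_sameCycle : ∀ d e : G.Dart, d.fst = e.fst → rot.SameCycle d e

namespace RotationSystem

variable {V : Type*} {G : SimpleGraph V}

/-- The face permutation: walk along a dart, turn around, and take the next dart there. -/
def facePerm (R : RotationSystem G) : Equiv.Perm G.Dart :=
  (SimpleGraph.Dart.symm_involutive (G := G)).toPerm.trans R.rot

/-- The faces are the orbits of the face permutation. -/
def Face (R : RotationSystem G) : Type _ :=
  Quotient (Equiv.Perm.SameCycle.setoid R.facePerm)

/-- The face whose boundary walk contains the dart `d`. -/
def face (R : RotationSystem G) (d : G.Dart) : R.Face :=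
  Quotient.mk (Equiv.Perm.SameCycle.setoid R.facePerm) d

/-- The length of the boundary walk of a face. -/
noncomputable def faceLength (R : RotationSystem G) (f : R.Face) : ℕ :=
  Nat.card {d : G.Dart // R.face d = f}

/-- The vertices on the boundary of a face. -/
def faceVertices (R : RotationSystem G) (f : R.Face) : Set V :=
  {v | ∃ d : G.Dart, R.face d = f ∧ d.fst = v}

end RotationSystem

/-- A plane drawing of a connected graph with at least one edge: a rotation system satisfying
Euler's formula, together with a choice of the outer face. -/
structure PlaneDrawing {V : Type*} (G : SimpleGraph V) extends RotationSystem G where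
  connected : G.Connected
  euler : (Nat.card V : ℤ) - Nat.card G.edgeSet + Nat.card toRotationSystem.Face = 2
  outer : toRotationSystem.Face

/-- A near-triangulation: a plane graph all of whose faces except possibly the outer one are
triangles (in a simple graph, a face of length three is bounded by a 3-cycle). -/
structure NearTriangulation {V : Type*} (G : SimpleGraph V) extends PlaneDrawing G where
  inner_triangle : ∀ f, f ≠ outer → toRotationSystem.faceLength f = 3

/-- The set `t` is the vertex set of a triangle (3-cycle, not necessarily a face) of `G`. -/
def IsTriangleOf {V : Type*} (G : SimpleGraph V) (t : Set V) : Prop :=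
  ∃ x y z : V, G.Adj x y ∧ G.Adj y z ∧ G.Adj x z ∧ t = {x, y, z}

namespace PlaneDrawing

variable {V : Type*} {G : SimpleGraph V}

/-- Two faces share an edge that does not have both ends in `t`. When `t` is a triangle, this
says that one can pass from `f` to `g` across an edge without crossing the triangle. -/
def FaceStep (D : PlaneDrawing G) (t : Set V) (f g : D.Face) : Prop :=
  ∃ d : G.Dart, ¬ (d.fst ∈ t ∧ d.snd ∈ t) ∧ D.face d = f ∧ D.face d.symm = g

/-- The face `f` lies outside the triangle `t`: it can be reached from the outer face without
crossing `t`. -/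
def FaceOutside (D : PlaneDrawing G) (t : Set V) (f : D.Face) : Prop :=
  Relation.ReflTransGen (D.FaceStep t) D.outer f

/-- The vertex `v` lies (strictly) inside the triangle `t`. -/
def Inside (D : PlaneDrawing G) (t : Set V) (v : V) : Prop :=
  v ∉ t ∧ ∀ d : G.Dart, d.fst = v → ¬ D.FaceOutside t (D.face d)

/-- The vertex `v` subdivides the triangle `t`: it lies inside `t` and is joined to all three
vertices of `t`. -/
def Subdivides (D : PlaneDrawing G) (v : V) (t : Set V) : Prop :=
  IsTriangleOf G t ∧ D.Inside t v ∧ ∀ x ∈ t, G.Adj v x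

/-- The triangle `t` arises from a face subdivision: it is one of the three inner triangles
`{v, x, y}` into which a vertex `v` subdivides some triangle of `G`. -/
def ArisesFromSubdivision (D : PlaneDrawing G) (t : Set V) : Prop :=
  ∃ (v : V) (s : Set V), D.Subdivides v s ∧
    ∃ x ∈ s, ∃ y ∈ s, x ≠ y ∧ t = {v, x, y}

/-- Type 3: among the triangles other than the outer one, there is one that arises from a face
subdivision and one that does not. -/
def IsType3 (D : PlaneDrawing G) : Prop :=
  (∃ t, IsTriangleOf G t ∧ t ≠ D.faceVertices D.outer ∧ D.ArisesFromSubdivision t) ∧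
  (∃ t, IsTriangleOf G t ∧ t ≠ D.faceVertices D.outer ∧ ¬ D.ArisesFromSubdivision t)

end PlaneDrawing

/-! ### The graphs `A`, `A'`, `A''`, `A'''` -/

/-- The edges of `A`: the triangle `1 3 5` with a vertex `6` joined to all of it, and vertices
`0`, `2`, `4` joined to the two ends of the edges `1 5`, `1 3`, `3 5` respectively. -/
def edgesA : List (Fin 7 × Fin 7) :=
  [(1, 3), (3, 5), (1, 5), (6, 1), (6, 3), (6, 5),
   (0, 1), (0, 5), (2, 1), (2, 3), (4, 3), (4, 5)]

/-- The graph `A`. -/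
def graphA : SimpleGraph (Fin 7) :=
  SimpleGraph.fromRel fun a b => (a, b) ∈ edgesA

/-- The graph `A'`: `A` with one edge among `0`, `2`, `4`. -/
def graphA' : SimpleGraph (Fin 7) :=
  SimpleGraph.fromRel fun a b => (a, b) ∈ edgesA ++ [(0, 4)]

/-- The graph `A''`: `A` with two edges among `0`, `2`, `4`. -/
def graphA'' : SimpleGraph (Fin 7) :=
  SimpleGraph.fromRel fun a b => (a, b) ∈ edgesA ++ [(0, 2), (2, 4)]

/-- The graph `A'''`: `A` with all three edges among `0`, `2`, `4`. -/
def graphA''' : SimpleGraph (Fin 7) :=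
  SimpleGraph.fromRel fun a b => (a, b) ∈ edgesA ++ [(0, 4), (0, 2), (2, 4)]

/-! The goal is a crowned tetrahedron: a K4 with an apex `d` such that each edge of the triangle
opposite `d` has a vertex whose neighbours in the K4 are exactly the ends of that edge. Its seven
vertices induce one of the four graphs. It also rules out words: alternation orients each edge by
which letter leads, a K4 becomes a linear order s₁s₂s₃s₄, and counting in prefixes forbids a vertex
attached to exactly {s₁,s₃} or exactly {s₂,s₄}. One of these complementary pairs misses `d`, hence
is a crowned edge.

To find one, start from the K4 given by a subdividing vertex. All faces are triangles, so
consecutive neighbours of a vertex are adjacent; hence in any component off a triangle, each edge of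
the triangle has a common neighbour. If that component misses the apex, these neighbours form a
crown, unless one sees the whole triangle and gives a new K4. Stepping in this way towards a
triangle `t` that does not arise from a subdivision shrinks the component ahead, so a crown appears
or `t` lies in a K4. In the last case the apex is inside `t`, and a common neighbour of `t` on the
outer side would make `t` arise from a subdivision; so there is a crown again.

Euler's formula enters only through `exists_isCut` (boundaries of face sets are the orthogonal
complement of vertex stars mod 2), from which `exists_separated` follows. -/

/-! ### Rotations around a vertex, and triangular faces -/

namespace RotationSystem

variable {V : Type*} {G : SimpleGraph V}

/-- Rotating past a dart is crossing its edge; this turns face-to-face moves into rotations about a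
vertex. -/
theorem face_rot (R : RotationSystem G) (d : G.Dart) : R.face (R.rot d) = R.face d.symm := by
  refine Quotient.sound (s := Equiv.Perm.SameCycle.setoid R.facePerm) ?_
  refine (Equiv.Perm.SameCycle.symm ⟨1, ?_⟩ : R.facePerm.SameCycle (R.rot d) d.symm)
  simp [facePerm]

theorem fst_rot_pow (R : RotationSystem G) (d : G.Dart) (n : ℕ) :
    ((R.rot ^ n) d).fst = d.fst := by
  induction n with
  | zero => rfl
  | succ n ih => rw [pow_succ', Equiv.Perm.mul_apply, R.fst_rot, ih]

theorem finite_dart [Finite V] : Finite G.Dart :=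
  Finite.of_injective (fun d : G.Dart => d.toProd) (fun _ _ h => SimpleGraph.Dart.ext _ _ h)

theorem exists_rot_pow_eq [Finite V] (R : RotationSystem G) {d e : G.Dart} (h : d.fst = e.fst) :
    ∃ n : ℕ, (R.rot ^ n) d = e := by
  have := finite_dart (G := G)
  obtain ⟨n, hn⟩ := (R.rot_sameCycle d e h).exists_nat_pow_eq
  exact ⟨n, hn⟩

/-- Rotating from `d`, one meets a dart satisfying `P` before any quantity that changes only
across darts satisfying `P` has changed. -/
theorem exists_first_hit [Finite V] (R : RotationSystem G) {α : Type*} (P : G.Dart → Prop)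
    (φ : G.Dart → α) {d e : G.Dart} (he : d.fst = e.fst) (hP : P e)
    (hφ : ∀ d', d'.fst = d.fst → ¬ P d' → φ (R.rot d') = φ d') :
    ∃ e', e'.fst = d.fst ∧ P e' ∧ φ e' = φ d := by
  obtain ⟨n, hn⟩ := R.exists_rot_pow_eq he
  have key : ∀ n : ℕ, (∃ e', e'.fst = d.fst ∧ P e' ∧ φ e' = φ d) ∨ φ ((R.rot ^ n) d) = φ d := by
    intro n
    induction n with
    | zero => exact Or.inr rfl
    | succ n ih =>
      rcases ih with ih | ih
      · exact Or.inl ih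
      · by_cases hp : P ((R.rot ^ n) d)
        · exact Or.inl ⟨_, R.fst_rot_pow d n, hp, ih⟩
        · right
          rw [pow_succ', Equiv.Perm.mul_apply, hφ _ (R.fst_rot_pow d n) hp, ih]
  rcases key n with h | h
  · exact h
  · exact ⟨e, he.symm, hP, by rw [← hn, h]⟩

theorem eq_of_fst_eq [Finite V] (R : RotationSystem G) {α : Type*} (φ : G.Dart → α)
    {d e : G.Dart} (he : d.fst = e.fst) (hφ : ∀ d', d'.fst = d.fst → φ (R.rot d') = φ d') :
    φ d = φ e := by
  obtain ⟨e', _, rfl, h⟩ := R.exists_first_hit (fun d' => d' = e) φ he rfl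
    (fun d' hd _ => hφ d' hd)
  exact h.symm

/-- Cutting the cyclic order at `z` leaves a linear, hence connected, order. -/
theorem iff_of_ne [Finite V] (R : RotationSystem G) (Q : G.Dart → Prop) {z : G.Dart}
    (hQ : ∀ d, d.fst = z.fst → d ≠ z → R.rot d ≠ z → (Q (R.rot d) ↔ Q d))
    {d e : G.Dart} (hd : d.fst = z.fst) (he : e.fst = z.fst) (hdz : d ≠ z) (hez : e ≠ z) :
    Q d ↔ Q e := by
  have key : ∀ n : ℕ, (R.rot ^ n) z = z ∨ (Q ((R.rot ^ n) z) ↔ Q (R.rot z)) := by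
    intro n
    induction n with
    | zero => exact Or.inl rfl
    | succ n ih =>
      rw [pow_succ', Equiv.Perm.mul_apply]
      rcases ih with ih | ih
      · rw [ih]; exact Or.inr Iff.rfl
      · by_cases h1 : (R.rot ^ n) z = z
        · rw [h1]; exact Or.inr Iff.rfl
        by_cases h2 : R.rot ((R.rot ^ n) z) = z
        · exact Or.inl h2
        · exact Or.inr ((hQ _ (R.fst_rot_pow z n) h1 h2).trans ih)
  have key' : ∀ d : G.Dart, d.fst = z.fst → d ≠ z → (Q d ↔ Q (R.rot z)) := by
    intro d hd hdz
    obtain ⟨n, rfl⟩ := R.exists_rot_pow_eq hd.symm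
    exact (key n).resolve_left hdz
  exact (key' d hd hdz).trans (key' e he hez).symm

theorem eq_of_connected [Finite V] (R : RotationSystem G) (hG : G.Connected) {α : Type*}
    (φ : R.Face → α) (h : ∀ d : G.Dart, φ (R.face d) = φ (R.face d.symm)) (d e : G.Dart) :
    φ (R.face d) = φ (R.face e) := by
  have hrot : ∀ d e : G.Dart, d.fst = e.fst → φ (R.face d) = φ (R.face e) := fun d e hde =>
    R.eq_of_fst_eq (fun d => φ (R.face d)) hde (fun d' _ => by rw [R.face_rot, h d'])
  obtain ⟨p⟩ := hG.preconnected d.fst e.fst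
  generalize hu : d.fst = u at p
  generalize hv : e.fst = v at p
  induction p generalizing d with
  | nil => exact hrot d e (hu.trans hv.symm)
  | @cons u v' w huv p ih =>
    calc φ (R.face d) = φ (R.face ⟨(u, v'), huv⟩) := hrot _ _ hu
      _ = φ (R.face (SimpleGraph.Dart.symm ⟨(u, v'), huv⟩)) := h _
      _ = φ (R.face e) := ih _ rfl hv

/-- The minimal period of a dart is the size of its orbit, which is the face length. -/
theorem facePerm_three [Finite V] (R : RotationSystem G) (h3 : ∀ f, R.faceLength f = 3)
    (d : G.Dart) : R.facePerm (R.facePerm (R.facePerm d)) = d := by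
  classical
  have := finite_dart (G := G)
  have := Fintype.ofFinite (MulAction.orbit (Subgroup.zpowers R.facePerm) d)
  have hper : Function.minimalPeriod (R.facePerm • ·) d = 3 := by
    rw [MulAction.minimalPeriod_eq_card, ← Nat.card_eq_fintype_card, ← h3 (R.face d)]
    refine Nat.card_congr (Equiv.subtypeEquivRight fun e => ?_)
    rw [MulAction.mem_orbit_iff]
    refine Iff.trans ?_ (Quotient.eq (r := Equiv.Perm.SameCycle.setoid R.facePerm)).symm
    constructor
    · rintro ⟨⟨_, n, rfl⟩, h⟩
      exact Equiv.Perm.SameCycle.symm ⟨n, h⟩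
    · intro h
      obtain ⟨n, hn⟩ := Equiv.Perm.SameCycle.symm h
      exact ⟨⟨_, n, rfl⟩, hn⟩
  have h := Function.iterate_minimalPeriod (f := (R.facePerm • ·)) (x := d)
  rw [hper] at h
  exact h

/-- Around a vertex of a triangulation, consecutive neighbours are adjacent. -/
theorem adj_snd_rot [Finite V] (R : RotationSystem G) (h3 : ∀ f, R.faceLength f = 3)
    (d : G.Dart) : G.Adj d.snd (R.rot d).snd := by
  have := finite_dart (G := G)
  have hp : R.facePerm (R.facePerm (R.facePerm d.symm)) = d.symm := R.facePerm_three h3 _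
  have h1 : R.facePerm d.symm = R.rot d := by simp [facePerm]
  have h2 : ∀ d, (R.facePerm d).fst = d.snd := by
    intro d
    simp [facePerm, R.fst_rot]
  have h4 := (R.facePerm (R.facePerm d.symm)).adj
  have h5 := h2 (R.facePerm (R.facePerm d.symm))
  rw [h2, ← h5, hp, h1] at h4
  exact h4.symm

end RotationSystem

/-! ### Dimension counts -/

/-- The dot product is nondegenerate, so the dimension bound forces `W` to be the whole orthogonal
complement of `U`. -/
theorem mem_of_card_le_finrank_add {K ι : Type*} [Field K] [Fintype ι] (U W : Submodule K (ι → K))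
    (hUW : ∀ u ∈ U, ∀ w ∈ W, u ⬝ᵥ w = 0)
    (hdim : Fintype.card ι ≤ Module.finrank K U + Module.finrank K W)
    {τ : ι → K} (hτ : ∀ u ∈ U, u ⬝ᵥ τ = 0) : τ ∈ W := by
  classical
  let B : LinearMap.BilinForm K (ι → K) := dotProductBilin K K
  have hB : B.ker = ⊥ := by
    rw [LinearMap.ker_eq_bot']
    intro v hv
    refine dotProduct_eq_zero v fun w => ?_
    exact congrArg (fun f => f w) hv
  have h1 := LinearMap.BilinForm.finrank_add_finrank_orthogonal' (B := B) U
  rw [hB, inf_bot_eq, finrank_bot, add_zero, Module.finrank_pi] at h1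
  have hle : W ≤ B.orthogonal U := fun w hw u hu => hUW u hu w hw
  rw [Submodule.eq_of_le_of_finrank_le hle (by lia)]
  exact fun u hu => hτ u hu

theorem finrank_range_of_ker_eq_const {K X E : Type*} [Field K] [Finite X] [Nonempty X]
    [AddCommGroup E] [Module K E] (L : (X → K) →ₗ[K] E)
    (h : ∀ k, L k = 0 → ∀ x y, k x = k y) : Nat.card X ≤ Module.finrank K (LinearMap.range L) + 1 := by
  have := Fintype.ofFinite X
  have hker : LinearMap.ker L ≤ Submodule.span K {fun _ => (1 : K)} := by
    intro k hk
    rw [Submodule.mem_span_singleton]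
    refine ⟨k (Classical.arbitrary X), ?_⟩
    ext x
    simpa using h k hk _ x
  have h1 := L.finrank_range_add_finrank_ker
  have h2 := (Submodule.finrank_mono hker).trans (finrank_span_le_card _)
  rw [Module.finrank_pi] at h1
  rw [Set.toFinset_singleton, Finset.card_singleton] at h2
  rw [Nat.card_eq_fintype_card]
  lia

/-! ### Mod 2 cycle space and the Jordan curve theorem -/

namespace PlaneDrawing

variable {V : Type*} {G : SimpleGraph V}

/-- The sum, over the two darts of each edge, of the values of a function on the vertices or
faces attached to these darts. -/
noncomputable def edgeSum [Fintype G.Dart] {X : Type*} (π : G.Dart → X) :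
    (X → ZMod 2) →ₗ[ZMod 2] (G.edgeSet → ZMod 2) := by
  classical exact
  { toFun := fun k e => ∑ d with (⟨d.edge, d.edge_mem⟩ : G.edgeSet) = e, k (π d)
    map_add' := fun k l => by ext e; simp [Finset.sum_add_distrib]
    map_smul' := fun c k => by ext e; simp [Finset.mul_sum] }

theorem edgeSum_apply [Fintype G.Dart] {X : Type*} (π : G.Dart → X) (k : X → ZMod 2)
    (d : G.Dart) : edgeSum π k ⟨d.edge, d.edge_mem⟩ = k (π d) + k (π d.symm) := by
  classical
  have h : (Finset.univ.filter fun d' : G.Dart =>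
      (⟨d'.edge, d'.edge_mem⟩ : G.edgeSet) = ⟨d.edge, d.edge_mem⟩) = {d, d.symm} := by
    ext d'
    simp [SimpleGraph.dart_edge_eq_iff]
  simp only [edgeSum, LinearMap.coe_mk, AddHom.coe_mk]
  convert Finset.sum_pair d.symm_ne.symm using 2

theorem edgeSum_dotProduct [Fintype G.Dart] [Fintype G.edgeSet] {X : Type*} (π : G.Dart → X)
    (k : X → ZMod 2) (g : G.edgeSet → ZMod 2) :
    edgeSum π k ⬝ᵥ g = ∑ d : G.Dart, k (π d) * g ⟨d.edge, d.edge_mem⟩ := by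
  classical
  rw [← Finset.sum_fiberwise _ (fun d : G.Dart => (⟨d.edge, d.edge_mem⟩ : G.edgeSet))]
  refine Finset.sum_congr rfl fun e _ => ?_
  simp only [edgeSum, LinearMap.coe_mk, AddHom.coe_mk, Finset.sum_mul]
  refine Finset.sum_congr (by congr!) fun d hd => ?_
  rw [(Finset.mem_filter.1 hd).2]

/-- The function `χ` on the faces changes exactly across the edges inside `t`. -/
def IsCut (D : PlaneDrawing G) (t : Set V) (χ : D.Face → ZMod 2) : Prop :=
  ∀ d : G.Dart, ((d.fst ∈ t ∧ d.snd ∈ t) → χ (D.face d.symm) = χ (D.face d) + 1) ∧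
    (¬ (d.fst ∈ t ∧ d.snd ∈ t) → χ (D.face d.symm) = χ (D.face d))

theorem IsCut.eq_of_fst_eq [Finite V] {D : PlaneDrawing G} {t : Set V} {χ : D.Face → ZMod 2}
    (h : D.IsCut t χ) {d e : G.Dart} (hde : d.fst = e.fst) (ht : d.fst ∉ t) :
    χ (D.face d) = χ (D.face e) :=
  D.toRotationSystem.eq_of_fst_eq (fun d => χ (D.face d)) hde (fun d' hd => by
    rw [D.face_rot]
    exact (h d').2 fun h => ht (hd ▸ h.1))

/-- `rot` permutes the darts at each vertex and carries the face of `d.symm` to that of `rot d`, so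
every term occurs twice. -/
theorem edgeSum_fst_dotProduct_edgeSum_face [Fintype G.Dart] [Fintype G.edgeSet]
    (D : PlaneDrawing G) (k : V → ZMod 2) (χ : D.Face → ZMod 2) :
    edgeSum (fun d : G.Dart => d.fst) k ⬝ᵥ edgeSum D.face χ = 0 := by
  rw [edgeSum_dotProduct]
  simp only [edgeSum_apply, mul_add, Finset.sum_add_distrib]
  have h : ∑ d : G.Dart, k d.fst * χ (D.face d) = ∑ d : G.Dart, k d.fst * χ (D.face d.symm) := by
    rw [← Equiv.sum_comp D.rot]
    simp only [D.fst_rot, D.face_rot]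
  rw [h]
  exact CharTwo.add_self_eq_zero _

/-- By connectedness the two ranges have dimension at least |V| − 1 and |F| − 1; Euler's formula
makes these add up to |E|. -/
theorem mem_range_edgeSum_face [Finite V] [Fintype G.Dart] [Fintype G.edgeSet] (D : PlaneDrawing G)
    {τ : G.edgeSet → ZMod 2} (hτ : ∀ k : V → ZMod 2, edgeSum (fun d : G.Dart => d.fst) k ⬝ᵥ τ = 0) :
    ∃ χ : D.Face → ZMod 2, edgeSum D.face χ = τ := by
  have hF : Finite D.Face := inferInstanceAs (Finite (Quotient _))
  have hF' : Nonempty D.Face := ⟨D.outer⟩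
  have hV : Nonempty V := D.connected.nonempty
  have h2 : ∀ a b : ZMod 2, a + b = 0 → a = b := by decide
  have hf := finrank_range_of_ker_eq_const (X := D.Face) (edgeSum D.face) (by
    intro k hk x y
    obtain ⟨d, rfl⟩ := Quotient.exists_rep x
    obtain ⟨e, rfl⟩ := Quotient.exists_rep y
    refine D.toRotationSystem.eq_of_connected D.connected k (fun d => h2 _ _ ?_) d e
    rw [← edgeSum_apply, hk]
    rfl)
  have hv := finrank_range_of_ker_eq_const (X := V) (edgeSum fun d : G.Dart => d.fst) (by
    intro k hk x y
    obtain ⟨p⟩ := D.connected.preconnected x y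
    induction p with
    | nil => rfl
    | @cons u v w huv p ih =>
      rw [← ih]
      refine h2 _ _ ?_
      have := edgeSum_apply (fun d : G.Dart => d.fst) k ⟨(u, v), huv⟩
      rw [hk] at this
      exact this.symm)
  have he := D.euler
  rw [Nat.card_eq_fintype_card (α := G.edgeSet)] at he
  refine mem_of_card_le_finrank_add (LinearMap.range (edgeSum fun d : G.Dart => d.fst))
    (LinearMap.range (edgeSum D.face)) ?_ (by lia) ?_
  · rintro _ ⟨k, rfl⟩ _ ⟨χ, rfl⟩
    exact D.edgeSum_fst_dotProduct_edgeSum_face k χ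
  · rintro _ ⟨k, rfl⟩
    exact hτ k

/-- The Jordan curve theorem for triangles. -/
theorem exists_isCut [Finite V] (D : PlaneDrawing G) {x y z : V} (hxy : G.Adj x y)
    (hyz : G.Adj y z) (hxz : G.Adj x z) : ∃ χ, D.IsCut {x, y, z} χ := by
  classical
  have := RotationSystem.finite_dart (G := G)
  have := Fintype.ofFinite G.Dart
  have := Fintype.ofFinite G.edgeSet
  -- The indicator of the three edges is orthogonal to vertex stars, since each corner meets two of
  -- them.
  obtain ⟨χ, hχ⟩ := D.mem_range_edgeSum_face
    (τ := Pi.single ⟨s(x, y), hxy⟩ 1 + Pi.single ⟨s(y, z), hyz⟩ 1 + Pi.single ⟨s(x, z), hxz⟩ 1) (by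
      intro k
      have h1 := edgeSum_apply (fun d : G.Dart => d.fst) k ⟨(x, y), hxy⟩
      have h2 := edgeSum_apply (fun d : G.Dart => d.fst) k ⟨(y, z), hyz⟩
      have h3 := edgeSum_apply (fun d : G.Dart => d.fst) k ⟨(x, z), hxz⟩
      simp only [SimpleGraph.Dart.edge, SimpleGraph.Dart.symm, Prod.swap] at h1 h2 h3
      simp only [dotProduct_add, dotProduct_single_one]
      erw [h1, h2, h3]
      generalize k x = a
      generalize k y = b
      generalize k z = c
      revert a b c
      decide)
  refine ⟨χ, fun d => ?_⟩
  have hxy' := hxy.ne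
  have hyz' := hyz.ne
  have hxz' := hxz.ne
  have hd : ((if d.edge = s(x, y) then 1 else 0) + (if d.edge = s(y, z) then 1 else 0) +
      (if d.edge = s(x, z) then 1 else 0) : ZMod 2) = χ (D.face d) + χ (D.face d.symm) := by
    rw [← edgeSum_apply, hχ]
    simp only [Pi.add_apply, Pi.single_apply, Subtype.ext_iff]
  have huv := d.fst_ne_snd
  have hedge : d.edge = s(d.fst, d.snd) := rfl
  simp only [hedge, Sym2.eq_iff] at hd
  generalize d.fst = u at *
  generalize d.snd = v at *
  have e1 : ∀ a b : ZMod 2, 1 = a + b → b = a + 1 := by decide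
  have e0 : ∀ a b : ZMod 2, 0 = a + b → b = a := by decide
  simp only [Set.mem_insert_iff, Set.mem_singleton_iff]
  constructor
  · rintro ⟨rfl | rfl | rfl, rfl | rfl | rfl⟩
    all_goals first
      | exact absurd rfl huv
      | apply e1
        simpa [hxy', hyz', hxz', hxy'.symm, hyz'.symm, hxz'.symm] using hd
  · intro h
    apply e0
    rw [← hd, if_neg (by grind), if_neg (by grind), if_neg (by grind)]
    simp

end PlaneDrawing

/-! ### The regions cut out by a K4 -/

namespace PlaneDrawing

variable {V : Type*} {G : SimpleGraph V}

theorem IsCut.eq_of_reflTransGen {D : PlaneDrawing G} {t : Set V} {χ : D.Face → ZMod 2}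
    (h : D.IsCut t χ) {f g : D.Face} (hfg : Relation.ReflTransGen (D.FaceStep t) f g) :
    χ f = χ g := by
  induction hfg with
  | refl => rfl
  | tail _ hstep ih =>
    obtain ⟨d, hd, rfl, rfl⟩ := hstep
    rw [ih, (h d).2 hd]

/-- A system of region indicators for the four triangles of the complete graph on `s`, the
indicator opposite to `v` vanishing near `v`. -/
structure IsCutSystem (D : PlaneDrawing G) (s : Finset V) (χ : V → D.Face → ZMod 2) : Prop where
  isCut : ∀ v ∈ s, D.IsCut ((s : Set V) \ {v}) (χ v)
  eq_zero : ∀ d : G.Dart, d.fst ∈ s → χ d.fst (D.face d) = 0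

namespace IsCutSystem

variable {D : PlaneDrawing G} {s : Finset V} {χ : V → D.Face → ZMod 2}

theorem eq_zero_snd (h : D.IsCutSystem s χ) (d : G.Dart) (hd : d.snd ∈ s) :
    χ d.snd (D.face d) = 0 := by
  have h1 : D.face (D.rot d.symm) = D.face d := D.face_rot d.symm
  have h2 : (D.rot d.symm).fst = d.snd := D.fst_rot d.symm
  have h3 := h.eq_zero (D.rot d.symm) (h2 ▸ hd)
  rwa [h1, h2] at h3

theorem flip (h : D.IsCutSystem s χ) (d : G.Dart) {v : V} (hv : v ∈ s) (h1 : d.fst ∈ s)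
    (h2 : d.snd ∈ s) (h3 : v ≠ d.fst) (h4 : v ≠ d.snd) :
    χ v (D.face d.symm) = χ v (D.face d) + 1 :=
  (h.isCut v hv d).1 ⟨⟨h1, h3.symm⟩, ⟨h2, h4.symm⟩⟩

/-- Crossing an edge of the K4 flips exactly the two indicators indexed by the vertices off that
edge; crossing any other edge flips none. -/
theorem sum_symm (h : D.IsCutSystem s χ) (hs : s.card = 4) (d : G.Dart) :
    ∑ v ∈ s, χ v (D.face d) = ∑ v ∈ s, χ v (D.face d.symm) := by
  classical
  by_cases hd : d.fst ∈ s ∧ d.snd ∈ s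
  · have h1 : ∀ v ∈ s, χ v (D.face d.symm) = χ v (D.face d) +
        if v ∈ (s.erase d.fst).erase d.snd then 1 else 0 := by
      intro v hv
      split_ifs with hvd
      · simp only [Finset.mem_erase] at hvd
        exact h.flip d hv hd.1 hd.2 hvd.2.1 hvd.1
      · rw [add_zero]
        refine (h.isCut v hv d).2 fun h' => hvd ?_
        simp only [Finset.mem_erase]
        exact ⟨fun h5 => h'.2.2 h5.symm, fun h5 => h'.1.2 h5.symm, hv⟩
    rw [Finset.sum_congr rfl h1, Finset.sum_add_distrib, Finset.sum_ite_mem,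
      Finset.inter_eq_right.2 ((Finset.erase_subset _ _).trans (Finset.erase_subset _ _)),
      Finset.sum_const, Finset.card_erase_of_mem (Finset.mem_erase.2 ⟨d.snd_ne_fst, hd.2⟩),
      Finset.card_erase_of_mem hd.1, hs]
    have : (((4 - 1 - 1 : ℕ) • 1 : ZMod 2)) = 0 := by decide
    rw [this, add_zero]
  · refine Finset.sum_congr rfl fun v hv => ?_
    exact ((h.isCut v hv d).2 fun h' => hd ⟨h'.1.1, h'.2.1⟩).symm

theorem sum_eq [Finite V] (h : D.IsCutSystem s χ) (hs : s.card = 4) (f g : D.Face) :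
    ∑ v ∈ s, χ v f = ∑ v ∈ s, χ v g := by
  obtain ⟨d, rfl⟩ := Quotient.exists_rep f
  obtain ⟨e, rfl⟩ := Quotient.exists_rep g
  exact D.toRotationSystem.eq_of_connected D.connected (fun f => ∑ v ∈ s, χ v f)
    (h.sum_symm hs) d e

theorem exists_other (hs : s.card = 4) (a b : V) : ∃ v ∈ s, v ≠ a ∧ v ≠ b := by
  classical
  have h1 : 0 < ((s.erase a).erase b).card := by
    have := Finset.pred_card_le_card_erase (s := s) (a := a)
    have := Finset.pred_card_le_card_erase (s := s.erase a) (a := b)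
    lia
  obtain ⟨v, hv⟩ := Finset.card_pos.1 h1
  simp only [Finset.mem_erase] at hv
  exact ⟨v, hv.2.2, hv.2.1, hv.1⟩

/-- Rotating from `d` to the next K4 edge `e` at the same vertex stays in one region. That region
touches three vertices of `s`, so three indicators vanish there, and the zero sum kills the fourth.
-/
theorem eq_zero_of_sum_eq_zero [Finite V] (h : D.IsCutSystem s χ) (hs : s.card = 4)
    (hsum : ∀ f, ∑ v ∈ s, χ v f = 0) (d : G.Dart) (hd1 : d.fst ∈ s) (hd2 : d.snd ∈ s) {v : V}
    (hv : v ∈ s) : χ v (D.face d.symm) = 0 := by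
  classical
  obtain ⟨e, he1, he2, he3⟩ := D.toRotationSystem.exists_first_hit (fun d' => d'.snd ∈ s)
    (fun d' => fun v : s => χ v (D.face d')) (D.fst_rot d) hd2 (by
      intro d' _ hd'
      ext v
      rw [D.face_rot]
      exact (h.isCut v v.2 d').2 fun h' => hd' h'.2.1)
  rw [D.face_rot] at he3
  rw [D.fst_rot] at he1
  have he : ∀ v ∈ s, χ v (D.face e) = χ v (D.face d.symm) := fun v hv => congrFun he3 ⟨v, hv⟩
  -- A full turn back to `d` would give both sides of `d` the same indicators, but crossing `d`
  -- flips some.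
  have hne : e.snd ≠ d.snd := by
    intro h1
    have h2 : e = d := SimpleGraph.Dart.ext _ _ (Prod.ext he1 h1)
    obtain ⟨w, hw, hwa, hwb⟩ := exists_other hs d.fst d.snd
    have h3 := h.flip d hw hd1 hd2 hwa hwb
    rw [← he w hw, h2] at h3
    exact absurd h3 (by generalize χ w (D.face d) = x; revert x; decide)
  have ha : χ d.fst (D.face d.symm) = 0 := h.eq_zero_snd d.symm hd1
  have hb : χ d.snd (D.face d.symm) = 0 := h.eq_zero d.symm hd2
  have hc : χ e.snd (D.face d.symm) = 0 := by
    rw [← he _ he2]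
    exact h.eq_zero_snd e he2
  by_contra hv0
  have hva : v ≠ d.fst := fun h' => hv0 (h' ▸ ha)
  have hvb : v ≠ d.snd := fun h' => hv0 (h' ▸ hb)
  have hvc : v ≠ e.snd := fun h' => hv0 (h' ▸ hc)
  have hea : e.snd ≠ d.fst := fun h' => e.snd_ne_fst (h'.trans he1.symm)
  have hs' : ({v, d.fst, d.snd, e.snd} : Finset V) = s := by
    refine Finset.eq_of_subset_of_card_le ?_ ?_
    · intro w hw
      simp only [Finset.mem_insert, Finset.mem_singleton] at hw
      rcases hw with rfl | rfl | rfl | rfl <;> assumption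
    · rw [hs, Finset.card_insert_of_notMem (by simp [*]),
        Finset.card_insert_of_notMem (by simp [d.fst_ne_snd, hea.symm]),
        Finset.card_pair hne.symm]
  have hS := hsum (D.face d.symm)
  rw [← hs', Finset.sum_insert (by simp [*]),
    Finset.sum_insert (by simp [d.fst_ne_snd, hea.symm]), Finset.sum_pair hne.symm, ha, hb, hc] at hS
  exact hv0 (by simpa using hS)

theorem sum_ne_zero [Finite V] (h : D.IsCutSystem s χ) (hs : s.card = 4) (hK : G.IsClique s) (f : D.Face) :
    ∑ v ∈ s, χ v f ≠ 0 := by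
  intro hf
  have hsum : ∀ g, ∑ v ∈ s, χ v g = 0 := fun g => (h.sum_eq hs g f).trans hf
  obtain ⟨a, ha⟩ := Finset.card_pos.1 (hs ▸ Nat.succ_pos 3 : 0 < s.card)
  obtain ⟨b, hb, hba, -⟩ := exists_other hs a a
  obtain ⟨c, hc, hca, hcb⟩ := exists_other hs a b
  let d : G.Dart := ⟨(a, b), hK ha hb hba.symm⟩
  have h1 := h.eq_zero_of_sum_eq_zero hs hsum d ha hb hc
  have h2 := h.eq_zero_of_sum_eq_zero hs hsum d.symm hb ha hc
  rw [SimpleGraph.Dart.symm_symm] at h2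
  have h3 := h.flip d hc ha hb hca hcb
  rw [h1, h2] at h3
  exact absurd h3 (by decide)

end IsCutSystem

theorem exists_isCut_of_card [Finite V] (D : PlaneDrawing G) {t : Finset V} (ht : t.card = 3)
    (hK : G.IsClique t) : ∃ χ, D.IsCut t χ := by
  classical
  obtain ⟨x, y, z, hxy, hxz, hyz, rfl⟩ := Finset.card_eq_three.1 ht
  have := D.exists_isCut (hK (by simp) (by simp) hxy) (hK (by simp) (by simp) hyz)
    (hK (by simp) (by simp) hxz)
  simpa using this

/-- In a plane drawing of a complete graph on four vertices, every face is separated from one of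
the vertices by the triangle formed by the other three. -/
theorem exists_separated [Finite V] (D : PlaneDrawing G) {s : Finset V} (hs : s.card = 4)
    (hK : G.IsClique s) (f : D.Face) :
    ∃ v ∈ s, ∀ d : G.Dart, d.fst = v →
      ¬ Relation.ReflTransGen (D.FaceStep ((s : Set V) \ {v})) f (D.face d) := by
  classical
  by_contra! hcon
  have key : ∀ v, ∃ χ : D.Face → ZMod 2, v ∈ s → D.IsCut ((s : Set V) \ {v}) χ ∧ χ f = 0 ∧
      ∀ d : G.Dart, d.fst = v → χ (D.face d) = 0 := by
    intro v
    by_cases hv : v ∈ s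
    · obtain ⟨d, hd, hreach⟩ := hcon v hv
      obtain ⟨χ, hχ⟩ := D.exists_isCut_of_card (t := s.erase v)
        (by rw [Finset.card_erase_of_mem hv, hs])
        (hK.subset (by simp))
      rw [Finset.coe_erase] at hχ
      -- Adding the constant `χ f` normalises the indicator to vanish at `f`, hence near `v`, which
      -- `f` reaches.
      refine ⟨fun g => χ g + χ f, fun _ => ⟨fun d => ?_, ?_, ?_⟩⟩
      · refine ⟨fun h => ?_, fun h => ?_⟩
        · simp only [(hχ d).1 h]; ring
        · simp only [(hχ d).2 h]
      · exact CharTwo.add_self_eq_zero _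
      · intro d' hd'
        have h1 : χ (D.face d') = χ (D.face d) :=
          hχ.eq_of_fst_eq (hd'.trans hd.symm) (by simp [hd'])
        simp only [h1, hχ.eq_of_reflTransGen hreach]
        exact CharTwo.add_self_eq_zero _
    · exact ⟨0, fun h => absurd h hv⟩
  choose χ hχ using key
  have hsys : D.IsCutSystem s χ :=
    ⟨fun v hv => (hχ v hv).1, fun d hd => (hχ _ hd).2.2 d rfl⟩
  exact hsys.sum_ne_zero hs hK f (Finset.sum_eq_zero fun v hv => (hχ v hv).2.1)

end PlaneDrawing

/-! ### Components off a triangle, and crowned tetrahedra -/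

section

variable {V : Type*} {G : SimpleGraph V}

/-- `v` can be reached from `u` by a walk which, after its first vertex, avoids `t`. -/
def AvoidReach (G : SimpleGraph V) (t : Set V) (u v : V) : Prop :=
  Relation.ReflTransGen (fun p q => G.Adj p q ∧ q ∉ t) u v

theorem AvoidReach.notMem {t : Set V} {u v : V} (h : AvoidReach G t u v) (hu : u ∉ t) : v ∉ t := by
  induction h with
  | refl => exact hu
  | tail _ h _ => exact h.2

theorem AvoidReach.symm {t : Set V} {u v : V} (h : AvoidReach G t u v) (hu : u ∉ t) :
    AvoidReach G t v u := by
  induction h with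
  | refl => exact Relation.ReflTransGen.refl
  | @tail b c hb hbc ih =>
    exact Relation.ReflTransGen.head ⟨hbc.1.symm, AvoidReach.notMem hb hu⟩ ih

theorem AvoidReach.exists_adj {t : Set V} {u x : V} (hG : G.Connected) (hu : u ∉ t) (hx : x ∈ t) :
    ∃ c, AvoidReach G t u c ∧ ∃ w ∈ t, G.Adj c w := by
  obtain ⟨p⟩ := hG.preconnected u x
  induction p with
  | nil => exact absurd hx hu
  | @cons u v x huv p ih =>
    by_cases hv : v ∈ t
    · exact ⟨u, Relation.ReflTransGen.refl, v, hv, huv⟩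
    · obtain ⟨c, hc, hw⟩ := ih hv hx
      exact ⟨c, Relation.ReflTransGen.head ⟨huv, hv⟩ hc, hw⟩

/-- A complete graph on `a, b, c, d` together with vertices `p`, `q`, `r` joined, among
`a, b, c, d`, exactly to the ends of `ab`, `bc`, `ac` respectively. -/
structure IsCrownedTetrahedron (G : SimpleGraph V) (a b c d p q r : V) : Prop where
  ab : G.Adj a b
  ac : G.Adj a c
  bc : G.Adj b c
  ad : G.Adj a d
  bd : G.Adj b d
  cd : G.Adj c d
  pa : G.Adj p a
  pb : G.Adj p b
  pc : ¬ G.Adj p c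
  pd : ¬ G.Adj p d
  qb : G.Adj q b
  qc : G.Adj q c
  qa : ¬ G.Adj q a
  qd : ¬ G.Adj q d
  ra : G.Adj r a
  rc : G.Adj r c
  rb : ¬ G.Adj r b
  rd : ¬ G.Adj r d

/-- `G` contains a crowned tetrahedron. -/
def HasCrownedTetrahedron (G : SimpleGraph V) : Prop :=
  ∃ a b c d p q r, IsCrownedTetrahedron G a b c d p q r

end

/-! ### Finding crowned tetrahedra in a triangulation -/

namespace PlaneDrawing

variable {V : Type*} {G : SimpleGraph V}

theorem reflTransGen_faceStep_of_fst_eq [Finite V] (D : PlaneDrawing G) {t : Set V}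
    {d e : G.Dart} (hde : d.fst = e.fst) (hd : d.fst ∉ t) :
    Relation.ReflTransGen (D.FaceStep t) (D.face d) (D.face e) := by
  obtain ⟨n, rfl⟩ := D.toRotationSystem.exists_rot_pow_eq hde
  clear hde
  induction n with
  | zero => exact Relation.ReflTransGen.refl
  | succ n ih =>
    rw [pow_succ', Equiv.Perm.mul_apply]
    refine ih.tail ⟨(D.rot ^ n) d, fun h => hd ?_, rfl, (D.face_rot _).symm⟩
    rw [← D.fst_rot_pow d n]
    exact h.1

theorem reflTransGen_faceStep_of_avoidReach [Finite V] (D : PlaneDrawing G) {t : Set V} {u v : V}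
    (h : AvoidReach G t u v) (hu : u ∉ t) {d e : G.Dart} (hd : d.fst = u) (he : e.fst = v) :
    Relation.ReflTransGen (D.FaceStep t) (D.face d) (D.face e) := by
  induction h generalizing e with
  | refl => exact D.reflTransGen_faceStep_of_fst_eq (hd.trans he.symm) (hd ▸ hu)
  | @tail b c hb hbc ih =>
    have h1 := ih (e := ⟨(b, c), hbc.1⟩) rfl
    refine (h1.tail ⟨_, fun h => hbc.2 h.2, rfl, rfl⟩).trans ?_
    exact D.reflTransGen_faceStep_of_fst_eq he.symm hbc.2

/-- Cut the cyclic order of neighbours of `x` at `z`. If no reachable neighbour of `x` were adjacent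
to `y`, reachability would pass between consecutive neighbours all the way from `c` to `y`, which
lies in `t`. -/
theorem exists_avoidReach_adj_adj_of_adj [Finite V] (D : PlaneDrawing G)
    (h3 : ∀ f, D.faceLength f = 3) {t : Set V} {x y z u c : V} (ht : ∀ v ∈ t, v = x ∨ v = y ∨ v = z)
    (hy : y ∈ t) (hz : z ∈ t) (hxy : G.Adj x y) (hyz : G.Adj y z) (hxz : G.Adj x z)
    (hu : u ∉ t) (hc : AvoidReach G t u c) (hcx : G.Adj c x) :
    ∃ c', AvoidReach G t u c' ∧ G.Adj c' x ∧ G.Adj c' y := by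
  by_contra! hcon
  have hlink : ∀ d : G.Dart, d.fst = x → G.Adj d.snd (D.rot d).snd := fun d _ =>
    D.toRotationSystem.adj_snd_rot h3 d
  have key : ∀ d e : G.Dart, d.fst = x → e.fst = x → e.snd ≠ z → G.Adj d.snd e.snd →
      AvoidReach G t u d.snd → AvoidReach G t u e.snd := by
    intro d e hd he hez hadj hr
    refine hr.tail ⟨hadj, fun h => ?_⟩
    rcases ht _ h with h | h | h
    · exact e.snd_ne_fst (h.trans he.symm)
    · exact hcon _ hr (hd ▸ d.adj.symm) (h ▸ hadj)
    · exact hez h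
  have hne : ∀ d : G.Dart, d.fst = x → d ≠ ⟨(x, z), hxz⟩ → d.snd ≠ z := by
    intro d hd hdz h
    exact hdz (SimpleGraph.Dart.ext _ _ (Prod.ext hd h))
  have h := D.toRotationSystem.iff_of_ne (z := ⟨(x, z), hxz⟩)
    (fun d => AvoidReach G t u d.snd) (d := ⟨(x, c), hcx.symm⟩) (e := ⟨(x, y), hxy⟩) (by
      intro d hd hdz hrdz
      have h1 : (D.rot d).fst = x := (D.fst_rot d).trans hd
      exact ⟨key _ _ h1 hd (hne _ hd hdz) (hlink d hd).symm,
        key _ _ hd h1 (hne _ h1 hrdz) (hlink d hd)⟩) rfl rfl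
    (fun h => hc.notMem hu (by simp at h; exact h ▸ hz)) (fun h => hyz.ne (by simpa using h))
  exact AvoidReach.notMem (h.1 hc) hu hy

theorem exists_avoidReach_adj_adj [Finite V] (D : PlaneDrawing G)
    (h3 : ∀ f, D.faceLength f = 3) {t : Set V} {x y z u : V} (ht : ∀ v ∈ t, v = x ∨ v = y ∨ v = z)
    (hx : x ∈ t) (hy : y ∈ t) (hz : z ∈ t) (hxy : G.Adj x y) (hyz : G.Adj y z) (hxz : G.Adj x z)
    (hu : u ∉ t) : ∃ c, AvoidReach G t u c ∧ G.Adj c x ∧ G.Adj c y := by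
  suffices h : ∃ c, AvoidReach G t u c ∧ G.Adj c x by
    obtain ⟨c, hc, hcx⟩ := h
    exact D.exists_avoidReach_adj_adj_of_adj h3 ht hy hz hxy hyz hxz hu hc hcx
  obtain ⟨c, hc, w, hw, hcw⟩ := AvoidReach.exists_adj D.connected hu hx
  rcases ht w hw with rfl | rfl | rfl
  · exact ⟨c, hc, hcw⟩
  · obtain ⟨c', hc', -, h⟩ := D.exists_avoidReach_adj_adj_of_adj h3 (by grind) hx hz
      hxy.symm hxz hyz hu hc hcw
    exact ⟨c', hc', h⟩
  · obtain ⟨c', hc', -, h⟩ := D.exists_avoidReach_adj_adj_of_adj h3 (by grind) hx hy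
      hxz.symm hxy hyz.symm hu hc hcw
    exact ⟨c', hc', h⟩

/-- A side of a triangle, away from a common neighbour `d` of its vertices, either yields a crowned
tetrahedron or contains another common neighbour. -/
theorem hasCrownedTetrahedron_or_exists_adj [Finite V] (D : PlaneDrawing G)
    (h3 : ∀ f, D.faceLength f = 3) {s : Finset V} (hs : s.card = 4) (hK : G.IsClique s)
    {d u : V} (hd : d ∈ s) (hu : u ∉ (s : Set V) \ {d})
    (hud : ¬ AvoidReach G ((s : Set V) \ {d}) u d) :
    HasCrownedTetrahedron G ∨
      ∃ e, AvoidReach G ((s : Set V) \ {d}) u e ∧ ∀ x ∈ (s : Set V) \ {d}, G.Adj e x := by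
  classical
  obtain ⟨a, b, c, hab, hac, hbc, habc⟩ := Finset.card_eq_three.1
    (show (s.erase d).card = 3 by rw [Finset.card_erase_of_mem hd, hs])
  have ht : (s : Set V) \ {d} = {a, b, c} := by
    rw [← Finset.coe_erase, habc]; simp
  have hmem : ∀ x ∈ ({a, b, c} : Set V), x ∈ s ∧ x ≠ d := fun x hx => by
    rw [← ht] at hx; exact hx
  obtain ⟨ha, had⟩ := hmem a (by simp)
  obtain ⟨hb, hbd⟩ := hmem b (by simp)
  obtain ⟨hc, hcd⟩ := hmem c (by simp)
  have hd' : d ∉ ({a, b, c} : Set V) := fun h => (hmem d h).2 rfl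
  rw [ht] at hu hud ⊢
  refine or_iff_not_imp_right.2 fun hcon => ?_
  have hcon' : ∀ e, AvoidReach G {a, b, c} u e → G.Adj e a → G.Adj e b → ¬ G.Adj e c := by
    intro e he h1 h2 h4
    refine hcon ⟨e, he, ?_⟩
    rintro x (rfl | rfl | rfl) <;> assumption
  have hnd : ∀ p, AvoidReach G {a, b, c} u p → ¬ G.Adj p d := fun p hp hpd =>
    hud (hp.tail ⟨hpd, hd'⟩)
  obtain ⟨p, hp, hpa, hpb⟩ := D.exists_avoidReach_adj_adj h3 (t := {a, b, c}) (x := a) (y := b)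
    (z := c) (by simp) (by simp) (by simp) (by simp) (hK ha hb hab) (hK hb hc hbc) (hK ha hc hac) hu
  obtain ⟨q, hq, hqb, hqc⟩ := D.exists_avoidReach_adj_adj h3 (t := {a, b, c}) (x := b) (y := c)
    (z := a) (by simp only [Set.mem_insert_iff, Set.mem_singleton_iff]; tauto) (by simp) (by simp) (by simp) (hK hb hc hbc) (hK hc ha hac.symm)
    (hK hb ha hab.symm) hu
  obtain ⟨r, hr, hra, hrc⟩ := D.exists_avoidReach_adj_adj h3 (t := {a, b, c}) (x := a) (y := c)
    (z := b) (by simp only [Set.mem_insert_iff, Set.mem_singleton_iff]; tauto) (by simp) (by simp) (by simp) (hK ha hc hac) (hK hc hb hbc.symm)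
    (hK ha hb hab) hu
  exact ⟨a, b, c, d, p, q, r, hK ha hb hab, hK ha hc hac, hK hb hc hbc, hK ha hd had,
    hK hb hd hbd, hK hc hd hcd, hpa, hpb, hcon' p hp hpa hpb, hnd p hp, hqb, hqc,
    fun h => hcon' q hq h hqb hqc, hnd q hq, hra, hrc, fun h => hcon' r hr hra h hrc, hnd r hr⟩

/-- Some vertex of the K4 is separated from the outer face by the other three, hence subdivides
their triangle. If it is not `w`, the triangle opposite `w` is one of the three pieces. -/
theorem arisesFromSubdivision_of_not_inside [Finite V] (D : PlaneDrawing G) {s : Finset V}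
    (hs : s.card = 4) (hK : G.IsClique s) {w : V} (hw : w ∈ s)
    (h : ¬ D.Inside ((s : Set V) \ {w}) w) : D.ArisesFromSubdivision ((s : Set V) \ {w}) := by
  classical
  obtain ⟨v, hv, hsep⟩ := D.exists_separated hs hK D.outer
  have hin : D.Inside ((s : Set V) \ {v}) v := ⟨by simp, hsep⟩
  have hvw : v ≠ w := by
    rintro rfl
    exact h hin
  obtain ⟨x, y, hxy, hs2⟩ := Finset.card_eq_two.1
    (show ((s.erase w).erase v).card = 2 by
      rw [Finset.card_erase_of_mem (Finset.mem_erase.2 ⟨hvw, hv⟩), Finset.card_erase_of_mem hw, hs])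
  have hmem : ∀ z, z ∈ ({x, y} : Finset V) ↔ z ≠ v ∧ z ≠ w ∧ z ∈ s := fun z => by
    rw [← hs2]; simp
  obtain ⟨hxv, hxw, hx⟩ := (hmem x).1 (by simp)
  obtain ⟨hyv, hyw, hy⟩ := (hmem y).1 (by simp)
  have hmem' : ∀ z, z ∈ s ↔ z = v ∨ z = w ∨ z = x ∨ z = y := by
    intro z
    have := hmem z
    simp only [Finset.mem_insert, Finset.mem_singleton] at this
    grind
  refine ⟨v, (s : Set V) \ {v}, ⟨⟨w, x, y, hK hw hx hxw.symm, hK hx hy hxy, hK hw hy hyw.symm, ?_⟩,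
    hin, fun z hz => hK hv hz.1 (Ne.symm hz.2)⟩, x, ⟨hx, hxv⟩, y, ⟨hy, hyv⟩, hxy, ?_⟩
  · ext z
    have := hmem' z
    simp only [Set.mem_sdiff, Finset.mem_coe, Set.mem_singleton_iff, Set.mem_insert_iff]
    grind
  · ext z
    have := hmem' z
    simp only [Set.mem_sdiff, Finset.mem_coe, Set.mem_singleton_iff, Set.mem_insert_iff]
    grind

/-- A triangle that does not arise from a face subdivision, is not the outer one, and lies in a
complete graph on four vertices, yields a crowned tetrahedron. -/
theorem hasCrownedTetrahedron_of_subset [Finite V] (D : PlaneDrawing G)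
    (h3 : ∀ f, D.faceLength f = 3) {s : Finset V} (hs : s.card = 4) (hK : G.IsClique s)
    {d : V} (hd : d ∈ s) (hna : ¬ D.ArisesFromSubdivision ((s : Set V) \ {d}))
    {o : G.Dart} (ho : D.face o = D.outer) (hos : o.fst ∉ (s : Set V) \ {d}) :
    HasCrownedTetrahedron G := by
  classical
  have hreach : ∀ v, AvoidReach G ((s : Set V) \ {d}) o.fst v → ∀ x : V, G.Adj v x →
      ¬ D.Inside ((s : Set V) \ {d}) v := by
    intro v hv x hvx hin
    refine hin.2 ⟨(v, x), hvx⟩ rfl ?_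
    have h1 := D.reflTransGen_faceStep_of_avoidReach hv hos (d := o) (e := ⟨(v, x), hvx⟩) rfl rfl
    rwa [ho] at h1
  obtain ⟨x, hx, hxd, -⟩ := IsCutSystem.exists_other hs d d
  rcases D.hasCrownedTetrahedron_or_exists_adj h3 hs hK hd hos (fun h =>
      hna (D.arisesFromSubdivision_of_not_inside hs hK hd (hreach d h x (hK hd hx hxd.symm))))
    with h | ⟨e, he, hadj⟩
  · exact h
  -- `e` is on the outer side of the triangle, so the K4 with `e` in place of `d` shows that the
  -- triangle arises from a subdivision.
  · exfalso
    have hes := he.notMem hos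
    have hcoe : ((insert e (s.erase d) : Finset V) : Set V) \ {e} = (s : Set V) \ {d} := by
      ext z
      simp only [Finset.coe_insert, Finset.coe_erase, Set.mem_sdiff, Set.mem_insert_iff,
        Set.mem_singleton_iff]
      constructor
      · rintro ⟨h | h, hz⟩
        · exact absurd h hz
        · exact h
      · intro h
        exact ⟨Or.inr h, fun hz => hes (hz ▸ h)⟩
    have hcard : (insert e (s.erase d)).card = 4 := by
      rw [Finset.card_insert_of_notMem (by rwa [← Finset.mem_coe, Finset.coe_erase]), Finset.card_erase_of_mem hd, hs]
    have hK' : G.IsClique (insert e (s.erase d) : Finset V) := by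
      rw [Finset.coe_insert, Finset.coe_erase]
      exact (hK.subset Set.sdiff_subset).insert fun b hb _ => hadj b hb
    have := D.arisesFromSubdivision_of_not_inside hcard hK' (Finset.mem_insert_self e _)
    rw [hcoe] at this
    exact hna (this (hreach e he x (hadj x ⟨hx, hxd⟩)))

/-- Moving from a complete graph on four vertices towards a triangle `t` beyond it. -/
theorem hasCrownedTetrahedron_of_avoidReach [Finite V] (D : PlaneDrawing G)
    (h3 : ∀ f, D.faceLength f = 3) {t : Set V} (ht : G.IsClique t)
    (hsub : ∀ s : Finset V, s.card = 4 → G.IsClique s → t ⊆ s → HasCrownedTetrahedron G) (n : ℕ) :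
    ∀ (s : Finset V) (d u : V), s.card = 4 → G.IsClique s → d ∈ s → u ∈ t →
      u ∉ (s : Set V) \ {d} → ¬ AvoidReach G ((s : Set V) \ {d}) u d →
      {v | AvoidReach G ((s : Set V) \ {d}) u v}.ncard < n → HasCrownedTetrahedron G := by
  classical
  induction n with
  | zero => intro _ _ _ _ _ _ _ _ _ h; exact absurd h (Nat.not_lt_zero _)
  | succ n ih =>
    intro s d u hs hK hd hut hus hud hn
    rcases D.hasCrownedTetrahedron_or_exists_adj h3 hs hK hd hus hud with h | ⟨e, he, hadj⟩
    · exact h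
    have hes := he.notMem hus
    set s' : Finset V := insert e (s.erase d) with hs'
    have hcoe : (s' : Set V) = insert e ((s : Set V) \ {d}) := by simp [hs']
    have hcard : s'.card = 4 := by
      rw [hs', Finset.card_insert_of_notMem (by rwa [← Finset.mem_coe, Finset.coe_erase]), Finset.card_erase_of_mem hd, hs]
    have hK' : G.IsClique s' := by
      rw [hcoe]
      exact (hK.subset Set.sdiff_subset).insert fun b hb _ => hadj b hb
    by_cases hts : t ⊆ s'
    · exact hsub s' hcard hK' hts
    obtain ⟨u', hu't, hu's⟩ := Set.not_subset.1 hts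
    have hu's0 : u' ∉ (s : Set V) \ {d} := fun h => hu's (hcoe ▸ Or.inr h)
    have huu' : AvoidReach G ((s : Set V) \ {d}) u u' := by
      by_cases h : u = u'
      · exact h ▸ Relation.ReflTransGen.refl
      · exact Relation.ReflTransGen.single ⟨ht hut hu't h, hu's0⟩
    have hu'e : AvoidReach G ((s : Set V) \ {d}) u' e := (huu'.symm hus).trans he
    obtain ⟨w, hu'w⟩ : ∃ w, G.Adj u' w := by
      rcases Relation.ReflTransGen.cases_head hu'e with h | ⟨w, hw, -⟩
      · exact absurd (h ▸ hu's) (by simp [hs'])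
      · exact ⟨w, hw.1⟩
    obtain ⟨v, hv, hsep⟩ := D.exists_separated hcard hK' (D.face ⟨(u', w), hu'w⟩)
    -- `u'` reaches `e` off the old triangle, so that triangle cannot separate them.
    have hve : v ≠ e := by
      rintro rfl
      have h1 : (s' : Set V) \ {v} = (s : Set V) \ {d} := by
        rw [hcoe]
        exact Set.insert_sdiff_self_of_notMem hes
      obtain ⟨x, hx, hxd, -⟩ := IsCutSystem.exists_other hs d d
      refine hsep ⟨(v, x), hadj x ⟨hx, hxd⟩⟩ rfl ?_
      rw [h1]
      exact D.reflTransGen_faceStep_of_avoidReach hu'e hu's0 rfl rfl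
    have hu's1 : u' ∉ (s' : Set V) \ {v} := fun h => hu's h.1
    have hu'v : ¬ AvoidReach G ((s' : Set V) \ {v}) u' v := by
      intro h
      have hev : G.Adj v e := hK' hv (Finset.mem_insert_self _ _) hve
      exact hsep ⟨(v, e), hev⟩ rfl (D.reflTransGen_faceStep_of_avoidReach h hu's1 rfl rfl)
    refine ih s' v u' hcard hK' hv hu't hu's1 hu'v (Nat.lt_of_lt_of_le ?_ (Nat.lt_succ_iff.1 hn))
    -- The new component lies in the old one, as it cannot reach `v`, and it has lost `e`, now a
    -- corner of the separating triangle.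
    refine Set.ncard_lt_ncard (Set.ssubset_iff_subset_ne.2 ⟨?_, ?_⟩) (Set.toFinite _)
    · intro x hx
      refine huu'.trans ?_
      change AvoidReach G _ u' x at hx
      change AvoidReach G _ u' x
      induction hx with
      | refl => exact Relation.ReflTransGen.refl
      | @tail b c hb hbc ihb =>
        refine ihb.tail ⟨hbc.1, fun hc => hbc.2 ⟨hcoe ▸ Or.inr hc, ?_⟩⟩
        rintro rfl
        exact hu'v (hb.tail hbc)
    · intro h
      have h1 : AvoidReach G ((s' : Set V) \ {v}) u' e := by
        change e ∈ {x | AvoidReach G ((s' : Set V) \ {v}) u' x}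
        rw [h]
        exact he
      exact h1.notMem hu's1 ⟨by simp [hs'], hve.symm⟩

end PlaneDrawing

/-! ### Type 3 yields a crowned tetrahedron -/

theorem IsTriangleOf.isClique {V : Type*} {G : SimpleGraph V} {t : Set V} (h : IsTriangleOf G t) :
    G.IsClique t := by
  obtain ⟨x, y, z, hxy, hyz, hxz, rfl⟩ := h
  rintro a (rfl | rfl | rfl) b (rfl | rfl | rfl) hab
  all_goals first
    | exact absurd rfl hab
    | assumption
    | (apply SimpleGraph.Adj.symm; assumption)

theorem IsTriangleOf.ncard {V : Type*} {G : SimpleGraph V} {t : Set V} (h : IsTriangleOf G t) :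
    t.ncard = 3 := by
  obtain ⟨x, y, z, hxy, hyz, hxz, rfl⟩ := h
  rw [Set.ncard_eq_three]
  exact ⟨x, y, z, hxy.ne, hxz.ne, hyz.ne, rfl⟩

/-- Every face of a triangulation contains the vertices of a triangle. -/
theorem PlaneDrawing.exists_isTriangleOf_subset_faceVertices {V : Type*} [Finite V] {G : SimpleGraph V}
    (D : PlaneDrawing G) (h3 : ∀ f, D.faceLength f = 3) (d : G.Dart) :
    ∃ t, IsTriangleOf G t ∧ t ⊆ D.faceVertices (D.face d) := by
  have hf : ∀ d, D.face (D.facePerm d) = D.face d := fun d => Quotient.sound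
    (s := Equiv.Perm.SameCycle.setoid D.facePerm)
    (Equiv.Perm.SameCycle.symm ⟨1, by simp⟩ : D.facePerm.SameCycle (D.facePerm d) d)
  have h2 : ∀ d, (D.facePerm d).fst = d.snd := by
    intro d
    simp [RotationSystem.facePerm, D.fst_rot]
  set e := D.facePerm d with he
  set g := D.facePerm e with hg
  have hgd : D.facePerm g = d := D.facePerm_three h3 d
  have h4 : g.snd = d.fst := by rw [← h2 g, hgd]
  refine ⟨{d.fst, e.fst, g.fst}, ⟨_, _, _, ?_, ?_, ?_, rfl⟩, ?_⟩
  · rw [he, h2]; exact d.adj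
  · rw [hg, h2 e]; exact e.adj
  · rw [← h4]; exact g.adj.symm
  · rintro v (rfl | rfl | rfl)
    · exact ⟨d, rfl, rfl⟩
    · exact ⟨e, hf d, rfl⟩
    · exact ⟨g, (hf e).trans (hf d), rfl⟩

theorem NearTriangulation.hasCrownedTetrahedron {V : Type*} [Finite V] {G : SimpleGraph V}
    (T : NearTriangulation G) (houter : T.faceLength T.outer = 3) (htype : T.IsType3) :
    HasCrownedTetrahedron G := by
  classical
  have h3 : ∀ f, T.faceLength f = 3 := fun f => by
    by_cases h : f = T.outer
    · rw [h, houter]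
    · exact T.inner_triangle f h
  obtain ⟨⟨t₁, -, -, v, s₀, ⟨hs₀, hv, hadj⟩, -⟩, t, ht, hto, hna⟩ := htype
  -- Otherwise `t` would be the vertex set of the outer face.
  obtain ⟨o, ho, hot⟩ : ∃ o : G.Dart, T.face o = T.outer ∧ o.fst ∉ t := by
    by_contra! hcon
    obtain ⟨d, hd⟩ := Quotient.exists_rep T.outer
    obtain ⟨t', ht', hsub⟩ := T.exists_isTriangleOf_subset_faceVertices h3 d
    have hd' : T.face d = T.outer := hd
    rw [hd'] at hsub
    have hle : T.faceVertices T.outer ⊆ t := by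
      rintro _ ⟨e, he, rfl⟩
      exact hcon e he
    have h1 : t' = t := Set.eq_of_subset_of_ncard_le (hsub.trans hle)
      (by rw [ht.ncard, ht'.ncard]) (Set.toFinite _)
    exact hto (Set.Subset.antisymm (h1 ▸ hsub) hle)
  have hsub : ∀ s : Finset V, s.card = 4 → G.IsClique s → t ⊆ s → HasCrownedTetrahedron G := by
    intro s hs hK hts
    obtain ⟨d, hd, hdt⟩ : ∃ d ∈ s, d ∉ t := by
      by_contra! hcon
      have h1 := Set.ncard_le_ncard (s := (s : Set V)) (t := t) hcon (Set.toFinite _)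
      rw [Set.ncard_coe_finset, hs, ht.ncard] at h1
      exact absurd h1 (by decide)
    have h1 : t = (s : Set V) \ {d} := by
      refine Set.eq_of_subset_of_ncard_le (fun x hx => ⟨hts hx, ?_⟩) ?_ (Set.toFinite _)
      · rintro rfl
        exact hdt hx
      · rw [ht.ncard, Set.ncard_sdiff_singleton_of_mem hd, Set.ncard_coe_finset, hs]
    rw [h1] at hna hot
    exact T.hasCrownedTetrahedron_of_subset h3 hs hK hd hna ho hot
  have hfin : s₀.Finite := Set.toFinite _
  set s : Finset V := insert v hfin.toFinset with hs
  have hcoe : (s : Set V) = insert v s₀ := by simp [hs]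
  have hcard : s.card = 4 := by
    rw [hs, Finset.card_insert_of_notMem (by simpa using hv.1), ← Set.ncard_eq_toFinset_card _ hfin,
      hs₀.ncard]
  have hK : G.IsClique s := by
    rw [hcoe]
    exact hs₀.isClique.insert fun b hb _ => hadj b hb
  by_cases hts : t ⊆ s
  · exact hsub s hcard hK hts
  obtain ⟨u, hut, hus⟩ := Set.not_subset.1 hts
  obtain ⟨u', hu't, huu'⟩ := Set.exists_ne_of_one_lt_ncard (by rw [ht.ncard]; decide) u
  have hadju : G.Adj u u' := ht.isClique hut hu't huu'.symm
  obtain ⟨d, hd, hsep⟩ := T.exists_separated hcard hK (T.face ⟨(u, u'), hadju⟩)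
  have hus' : u ∉ (s : Set V) \ {d} := fun h => hus h.1
  refine T.hasCrownedTetrahedron_of_avoidReach h3 ht.isClique hsub _ s d u hcard hK hd hut hus' ?_
    (Nat.lt_succ_self _)
  intro h
  obtain ⟨x, hx, hxd, -⟩ := PlaneDrawing.IsCutSystem.exists_other hcard d d
  exact hsep ⟨(d, x), hK hd hx hxd.symm⟩ rfl
    (T.reflTransGen_faceStep_of_avoidReach h hus' rfl rfl)

/-! ### Crowned tetrahedra and words -/

section

open scoped Classical in
/-- In every prefix of `w`, the letter `x` occurs as often as `y`, or once more. -/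
def Leads {V : Type*} (w : List V) (x y : V) : Prop :=
  ∀ u, u <+: w → u.count y ≤ u.count x ∧ u.count x ≤ u.count y + 1

variable {V : Type*}

/-- Stripping an initial `x` exchanges the roles of `x` and `y`, so the induction generalises over
both. -/
theorem leads_iff (w : List V) {x y : V} (hxy : x ≠ y) :
    Leads w x y ↔ WordAlternate w x y ∧
      open scoped Classical in
      (w.filter (fun a => decide (a = x ∨ a = y))).head? ≠ some y := by
  classical
  induction w generalizing x y with
  | nil => simp [Leads, WordAlternate]
  | cons a w ih =>
    have hcons : Leads (a :: w) x y ↔ ∀ u, u <+: w →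
        (a :: u).count y ≤ (a :: u).count x ∧ (a :: u).count x ≤ (a :: u).count y + 1 := by
      constructor
      · intro h u hu
        exact h (a :: u) ((List.prefix_cons_inj a).2 hu)
      · intro h u hu
        rcases List.prefix_cons_iff.1 hu with rfl | ⟨u', rfl, hu'⟩
        · simp
        · exact h u' hu'
    rw [hcons]
    by_cases hax : a = x
    · subst hax
      have h1 : (w.filter fun b => decide (b = a ∨ b = y)) =
          w.filter fun b => decide (b = y ∨ b = a) := by
        simp only [or_comm]
      have h2 := ih hxy.symm
      rw [Leads, WordAlternate, ← h1] at h2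
      simp only [WordAlternate, List.filter_cons, true_or, decide_true, if_true,
        List.isChain_cons, List.head?_cons, List.count_cons_self,
        List.count_cons_of_ne hxy]
      constructor
      · intro h
        obtain ⟨h3, h4⟩ := h2.1 fun u hu => by have := h u hu; lia
        refine ⟨⟨fun b hb hab => h4 (hab ▸ hb), h3⟩, by simpa using hxy⟩
      · rintro ⟨⟨h3, h4⟩, -⟩ u hu
        have := h2.2 ⟨h4, fun h => h3 a h rfl⟩ u hu
        lia
    by_cases hay : a = y
    · subst hay
      refine iff_of_false (fun h => ?_) (by simp)
      have := (h [] List.nil_prefix).1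
      simp [hxy.symm] at this
    · have h2 := ih hxy
      rw [Leads, WordAlternate] at h2
      simpa [WordAlternate, List.filter_cons, hax, hay, List.count_cons] using h2

theorem leads_or_leads {w : List V} {x y : V} (hxy : x ≠ y) (h : WordAlternate w x y) :
    Leads w x y ∨ Leads w y x := by
  classical
  have h1 : (w.filter fun b => decide (b = x ∨ b = y)) =
      w.filter fun b => decide (b = y ∨ b = x) := by
    simp only [or_comm]
  rw [leads_iff w hxy, leads_iff w hxy.symm, WordAlternate, WordAlternate, ← h1]
  rw [WordAlternate] at h
  by_cases hy : (w.filter fun b => decide (b = x ∨ b = y)).head? = some y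
  · right
    exact ⟨h, by rw [hy]; simpa using hxy.symm⟩
  · exact Or.inl ⟨h, hy⟩

theorem Leads.not_symm {w : List V} {x y : V} (hxy : x ≠ y) (hx : x ∈ w) (h : Leads w x y) :
    ¬ Leads w y x := by
  classical
  intro h'
  obtain ⟨s, t, rfl⟩ := List.append_of_mem hx
  have h1 := h s (List.prefix_append _ _)
  have h2 := h' s (List.prefix_append _ _)
  have h3 := h (s ++ [x]) ⟨t, by simp⟩
  have h4 := h' (s ++ [x]) ⟨t, by simp⟩
  simp only [List.count_append, List.count_singleton_self, List.count_cons_of_ne hxy,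
    List.count_nil] at h3 h4
  lia

/-- In each prefix the counts decrease weakly along the path, by at most one in total. This is the
shortcut-free property of semi-transitive orientations. -/
theorem Leads.of_path {w : List V} {a b c d : V} (hab : Leads w a b) (hbc : Leads w b c)
    (hcd : Leads w c d) (had : Leads w a d) : Leads w a c ∧ Leads w b d := by
  constructor <;>
  · intro u hu
    have := hab u hu
    have := hbc u hu
    have := hcd u hu
    have := had u hu
    lia

theorem Leads.of_cycle {w : List V} {a b c : V} (hab : Leads w a b) (hbc : Leads w b c)
    (hca : Leads w c a) : Leads w b a := by
  intro u hu
  have := hab u hu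
  have := hbc u hu
  have := hca u hu
  lia

theorem HasCrownedTetrahedron.not_wordRepresentable {G : SimpleGraph V}
    (h : HasCrownedTetrahedron G) : ¬ WordRepresentable G := by
  rintro ⟨w, hw, hG⟩
  have hadj : ∀ x y, x ≠ y → Leads w x y → G.Adj x y := fun x y hxy hl =>
    (hG x y hxy).1 ((leads_iff w hxy).1 hl).1
  have htot : ∀ x y, G.Adj x y → Leads w x y ∨ Leads w y x := fun x y hxy =>
    leads_or_leads hxy.ne ((hG x y hxy.ne).2 hxy)
  have hcyc : ∀ x y z, G.Adj x y → Leads w x y → Leads w y z → Leads w z x → False :=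
    fun x y z hxy h1 h2 h3 => h1.not_symm hxy.ne (hw x) (h1.of_cycle h2 h3)
  have hodd : ∀ s₁ s₂ s₃ s₄ p, G.Adj s₁ s₃ → Leads w s₁ s₂ → Leads w s₂ s₃ → Leads w s₃ s₄ →
      Leads w s₁ s₃ → Leads w s₁ s₄ → G.Adj p s₁ → G.Adj p s₃ → ¬ G.Adj p s₂ → ¬ G.Adj p s₄ →
      p ≠ s₂ → p ≠ s₄ → False := by
    intro s₁ s₂ s₃ s₄ p h13 l12 l23 l34 l13 l14 a1 a3 n2 n4 e2 e4
    rcases htot _ _ a1 with h1 | h1 <;> rcases htot _ _ a3 with h2 | h2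
    · exact n2 (hadj _ _ e2 (h1.of_path l12 l23 h2).1)
    · exact hcyc _ _ _ h13 l13 h2 h1
    · exact n4 (hadj _ _ e4 (h1.of_path h2 l34 l14).2)
    · exact n2 (hadj _ _ e2.symm (l12.of_path l23 h2 h1).2).symm
  have heven : ∀ s₁ s₂ s₃ s₄ p, G.Adj s₂ s₄ → Leads w s₁ s₂ → Leads w s₂ s₃ → Leads w s₃ s₄ →
      Leads w s₂ s₄ → Leads w s₁ s₄ → G.Adj p s₂ → G.Adj p s₄ → ¬ G.Adj p s₁ → ¬ G.Adj p s₃ →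
      p ≠ s₁ → p ≠ s₃ → False := by
    intro s₁ s₂ s₃ s₄ p h24 l12 l23 l34 l24 l14 a2 a4 n1 n3 e1 e3
    rcases htot _ _ a2 with h1 | h1 <;> rcases htot _ _ a4 with h2 | h2
    · exact n3 (hadj _ _ e3 (h1.of_path l23 l34 h2).1)
    · exact hcyc _ _ _ h24 l24 h2 h1
    · exact n1 (hadj _ _ e1.symm (l12.of_path h1 h2 l14).1).symm
    · exact n3 (hadj _ _ e3.symm (l23.of_path l34 h2 h1).2).symm
  obtain ⟨a, b, c, d, p, q, r, h⟩ := h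
  -- For a crowned edge x → y, the forbidden orders of the K4 are x z y t and t x z y.
  have htri : ∀ x y z t m, G.Adj x y → G.Adj m x → G.Adj m y → ¬ G.Adj m z → ¬ G.Adj m t →
      m ≠ z → m ≠ t → Leads w x y → (Leads w x z ∧ Leads w z y ∧ Leads w y t ∧ Leads w x t → False) ∧
      (Leads w t x ∧ Leads w x z ∧ Leads w z y ∧ Leads w t y → False) := by
    intro x y z t m hxy mx my mz mt ez et lxy
    exact ⟨fun ⟨h1, h2, h3, h4⟩ => hodd x z y t m hxy h1 h2 h3 lxy h4 mx my mz mt ez et,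
      fun ⟨h1, h2, h3, h4⟩ => heven t x z y m hxy h1 h2 h3 lxy h4 mx my mt mz et ez⟩
  have epc : p ≠ c := by rintro rfl; exact h.pd h.cd
  have epd : p ≠ d := by rintro rfl; exact h.pc h.cd.symm
  have eqa : q ≠ a := by rintro rfl; exact h.qd h.ad
  have eqd : q ≠ d := by rintro rfl; exact h.qa h.ad.symm
  have erb : r ≠ b := by rintro rfl; exact h.rd h.bd
  have erd : r ≠ d := by rintro rfl; exact h.rb h.bd.symm
  have k1 := htri a b c d p h.ab h.pa h.pb h.pc h.pd epc epd
  have k2 := htri b a c d p h.ab.symm h.pb h.pa h.pc h.pd epc epd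
  have k3 := htri a b d c p h.ab h.pa h.pb h.pd h.pc epd epc
  have k4 := htri b a d c p h.ab.symm h.pb h.pa h.pd h.pc epd epc
  have k5 := htri b c a d q h.bc h.qb h.qc h.qa h.qd eqa eqd
  have k6 := htri c b a d q h.bc.symm h.qc h.qb h.qa h.qd eqa eqd
  have k7 := htri b c d a q h.bc h.qb h.qc h.qd h.qa eqd eqa
  have k8 := htri c b d a q h.bc.symm h.qc h.qb h.qd h.qa eqd eqa
  have k9 := htri a c b d r h.ac h.ra h.rc h.rb h.rd erb erd
  have k10 := htri c a b d r h.ac.symm h.rc h.ra h.rb h.rd erb erd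
  have k11 := htri a c d b r h.ac h.ra h.rc h.rd h.rb erd erb
  have k12 := htri c a d b r h.ac.symm h.rc h.ra h.rd h.rb erd erb
  have c1 := hcyc a b c h.ab
  have c2 := hcyc a c b h.ac
  have c3 := hcyc a b d h.ab
  have c4 := hcyc a d b h.ad
  have c5 := hcyc a c d h.ac
  have c6 := hcyc a d c h.ad
  have c7 := hcyc b c d h.bc
  have c8 := hcyc b d c h.bd
  clear htri hodd heven hcyc hadj
  -- Of the 64 orientations of the K4, the cyclic ones contain a directed triangle and the 24 linear
  -- orders a forbidden crowned edge.
  rcases htot a b h.ab with l1 | l1 <;> rcases htot a c h.ac with l2 | l2 <;>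
  rcases htot b c h.bc with l3 | l3 <;> rcases htot a d h.ad with l4 | l4 <;>
  rcases htot b d h.bd with l5 | l5 <;> rcases htot c d h.cd with l6 | l6 <;>
  simp only [l1, l2, l3, l4, l5, l6, true_and, and_true, imp_false, not_true_eq_false, and_false, false_and,
    forall_const] at *

end

/-! ### Induced copies of the four graphs -/

/-- No two vertices of the pattern have equal neighbourhoods (`hl`), so matching adjacencies already
makes `f` injective; distinctness of the crown vertices need not be known beforehand. -/
theorem isIndContained_fromRel_of_iff {V : Type*} {G : SimpleGraph V} {n : ℕ}
    (l : List (Fin n × Fin n))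
    (hl : ∀ i j : Fin n, (∀ k, (i ≠ k ∧ ((i, k) ∈ l ∨ (k, i) ∈ l)) ↔
      (j ≠ k ∧ ((j, k) ∈ l ∨ (k, j) ∈ l))) → i = j) (f : Fin n → V)
    (hf : ∀ i j : Fin n, i < j → (G.Adj (f i) (f j) ↔ (i, j) ∈ l ∨ (j, i) ∈ l)) :
    (SimpleGraph.fromRel fun a b => (a, b) ∈ l).IsIndContained G := by
  have hf' : ∀ i j, G.Adj (f i) (f j) ↔ i ≠ j ∧ ((i, j) ∈ l ∨ (j, i) ∈ l) := by
    intro i j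
    rcases lt_trichotomy i j with h | rfl | h
    · rw [hf i j h]
      exact ⟨fun h' => ⟨h.ne, h'⟩, fun h' => h'.2⟩
    · simp
    · rw [G.adj_comm, hf j i h]
      exact ⟨fun h' => ⟨h.ne', h'.symm⟩, fun h' => h'.2.symm⟩
  refine ⟨⟨⟨f, fun i j hij => hl i j fun k => ?_⟩, ?_⟩⟩
  · rw [← hf', ← hf', hij]
  · intro i j
    exact hf' i j

namespace IsCrownedTetrahedron

variable {V : Type*} {G : SimpleGraph V} {a b c d p q r : V}

theorem rotate (h : IsCrownedTetrahedron G a b c d p q r) :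
    IsCrownedTetrahedron G b c a d q r p :=
  ⟨h.bc, h.ab.symm, h.ac.symm, h.bd, h.cd, h.ad, h.qb, h.qc, h.qa, h.qd, h.rc, h.ra, h.rb, h.rd,
    h.pb, h.pa, h.pc, h.pd⟩

theorem isIndContained (h : IsCrownedTetrahedron G a b c d p q r) (l : List (Fin 7 × Fin 7))
    (hl : ∀ i j : Fin 7, (∀ k, (i ≠ k ∧ ((i, k) ∈ edgesA ++ l ∨ (k, i) ∈ edgesA ++ l)) ↔
      (j ≠ k ∧ ((j, k) ∈ edgesA ++ l ∨ (k, j) ∈ edgesA ++ l))) → i = j)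
    (hl' : ∀ e ∈ l, e ∈ [((0 : Fin 7), (4 : Fin 7)), (0, 2), (2, 4)])
    (hrq : G.Adj r q ↔ (0, 4) ∈ l) (hrp : G.Adj r p ↔ (0, 2) ∈ l) (hpq : G.Adj p q ↔ (2, 4) ∈ l) :
    (SimpleGraph.fromRel fun a b => (a, b) ∈ edgesA ++ l).IsIndContained G := by
  refine isIndContained_fromRel_of_iff _ hl ![r, a, p, b, q, c, d] fun i j hij => ?_
  have hn : ∀ i j : Fin 7, (i, j) ∈ l ↔ ((i, j) = (0, 4) ∧ G.Adj r q) ∨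
      ((i, j) = (0, 2) ∧ G.Adj r p) ∨ ((i, j) = (2, 4) ∧ G.Adj p q) := by
    intro i j
    rw [hrq, hrp, hpq]
    constructor
    · intro h'
      have := hl' _ h'
      simp only [List.mem_cons, List.not_mem_nil, or_false] at this
      rcases this with e | e | e
      · exact Or.inl ⟨e, e ▸ h'⟩
      · exact Or.inr (Or.inl ⟨e, e ▸ h'⟩)
      · exact Or.inr (Or.inr ⟨e, e ▸ h'⟩)
    · rintro (⟨e, h'⟩ | ⟨e, h'⟩ | ⟨e, h'⟩) <;> exact e ▸ h'
  simp only [List.mem_append, hn]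
  clear hn hrq hrp hpq hl hl'
  have ap := h.pa.symm
  have bq := h.qb.symm
  have aq : ¬ G.Adj a q := fun h' => h.qa h'.symm
  obtain ⟨ab, ac, bc, ad, bd, cd, pa, pb, pc, pd, qb, qc, qa, qd, ra, rc, rb, rd⟩ := h
  fin_cases i <;> fin_cases j <;>
    first
    | exact absurd hij (by decide)
    | simp [edgesA, *]

set_option synthInstance.maxSize 1000 in
-- Rotating the crown reduces the eight adjacency patterns on `p`, `q`, `r` to four, one for each
-- number of edges.
theorem isIndContained_cases (h : IsCrownedTetrahedron G a b c d p q r) :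
    graphA.IsIndContained G ∨ graphA'.IsIndContained G ∨
      graphA''.IsIndContained G ∨ graphA'''.IsIndContained G := by
  have hA : ∀ {a b c p q r}, IsCrownedTetrahedron G a b c d p q r → ¬ G.Adj r q → ¬ G.Adj r p →
      ¬ G.Adj p q → graphA.IsIndContained G := fun h h1 h2 h3 => by
    have := h.isIndContained [] (by decide) (by decide) (by simpa) (by simpa) (by simpa)
    simp only [List.append_nil] at this
    exact this
  have hA' : ∀ {a b c p q r}, IsCrownedTetrahedron G a b c d p q r → G.Adj r q → ¬ G.Adj r p →
      ¬ G.Adj p q → graphA'.IsIndContained G := fun h h1 h2 h3 =>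
    h.isIndContained [(0, 4)] (by decide) (by decide) (by simpa) (by simpa) (by simpa)
  have hA'' : ∀ {a b c p q r}, IsCrownedTetrahedron G a b c d p q r → ¬ G.Adj r q → G.Adj r p →
      G.Adj p q → graphA''.IsIndContained G := fun h h1 h2 h3 =>
    h.isIndContained [(0, 2), (2, 4)] (by decide) (by decide) (by simpa) (by simpa) (by simpa)
  have hA''' : ∀ {a b c p q r}, IsCrownedTetrahedron G a b c d p q r → G.Adj r q → G.Adj r p →
      G.Adj p q → graphA'''.IsIndContained G := fun h h1 h2 h3 =>
    h.isIndContained [(0, 4), (0, 2), (2, 4)] (by decide) (by decide) (by simpa) (by simpa)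
      (by simpa)
  have h' := h.rotate
  have h'' := h'.rotate
  by_cases h1 : G.Adj r q <;> by_cases h2 : G.Adj r p <;> by_cases h3 : G.Adj p q
  · exact Or.inr (Or.inr (Or.inr (hA''' h h1 h2 h3)))
  · exact Or.inr (Or.inr (Or.inl (hA'' h'' (fun e => h3 e.symm) h1.symm h2)))
  · exact Or.inr (Or.inr (Or.inl (hA'' h' (fun e => h2 e.symm) h3 h1.symm)))
  · exact Or.inr (Or.inl (hA' h h1 h2 h3))
  · exact Or.inr (Or.inr (Or.inl (hA'' h h1 h2 h3)))
  · exact Or.inr (Or.inl (hA' h' h2.symm h3 (fun e => h1 e.symm)))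
  · exact Or.inr (Or.inl (hA' h'' h3.symm (fun e => h1 e.symm) h2))
  · exact Or.inl (hA h h1 h2 h3)

end IsCrownedTetrahedron

theorem lemmal3 {V : Type*} [Finite V] (G : SimpleGraph V) (T : NearTriangulation G)
    (houter : T.faceLength T.outer = 3) (htype : T.IsType3) :
    (graphA.IsIndContained G ∨ graphA'.IsIndContained G ∨
      graphA''.IsIndContained G ∨ graphA'''.IsIndContained G) ∧
    ¬ WordRepresentable G := by
  have h := T.hasCrownedTetrahedron houter htype
  refine ⟨?_, h.not_wordRepresentable⟩
  obtain ⟨a, b, c, d, p, q, r, h⟩ := h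
  exact h.isIndContained_cases
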